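/- Let $d\ge 0$, let $\langle u,\varphi\rangle$ denote the bracket on $\mathcal S'\times\mathcal S$, conjugate-linear in $\varphi$, that extends the $L^2$ inner product $\int f\bar g$, and for $x,\xi\in\mathbb R^{2d}$, $\tau\in\mathbb R$ let $\rho(x,\xi;\tau)f(t)=e^{2\pi i\tau}e^{-\pi i\xi\cdot x}e^{2\pi i\xi\cdot t}f(t-x)$ be the Schrödinger representation on $L^2(\mathbb R^{2d})$. Let $\mathcal A\in \mathrm{Sp}(2d,\mathbb R)$ (a symplectic $4d\times 4d$ matrix) and let $\hat{\mathcal A}$ be a metaplectic operator with projection $\mathcal A$, that is, a unitary operator on $L^2(\mathbb R^{2d})$ with $\hat{\mathcal A}\,\rho(z;\tau)\,\hat{\mathcal A}^{-1}=\rho(\mathcal A z;\tau)$ for all $z\in\mathbb R^{4d}$, $\tau\in\mathbb R$. Then $\hat{\mathcal A}$ and $\hat{\mathcal A}^{-1}$ restrict to continuous operators on $\mathcal S(\mathbb R^{2d})$, and hence act on $\mathcal S'(\mathbb R^{2d})$ by $\langle \hat{\mathcal A}^{\pm1}u,\varphi\rangle=\langle u,\hat{\mathcal A}^{\mp1}\varphi\rangle$.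 For $f,g\in\mathcal S(\mathbb R^d)$ put $W_{\mathcal A}(f,g)=\hat{\mathcal A}(f\otimes\bar g)\in\mathcal S(\mathbb R^{2d})$; for $b\in\mathcal S'(\mathbb R^{2d})$ let $\mathrm{Op}_{\mathcal A}(b):\mathcal S(\mathbb R^d)\to\mathcal S'(\mathbb R^d)$ be the continuous linear operator with $\langle \mathrm{Op}_{\mathcal A}(b)f,g\rangle=\langle b,W_{\mathcal A}(g,f)\rangle$ for all $f,g\in\mathcal S(\mathbb R^d)$; and for $\varphi_1,\varphi_2\in\mathcal S(\mathbb R^d)$ and $a\in\mathcal S'(\mathbb R^{2d})$ let $A_{a,\mathcal A}^{\varphi_1,\varphi_2}=\mathrm{Op}_{\mathcal A}\bigl(a*W_{\mathcal A}(\varphi_2,\varphi_1)\bigr)$. Then, for all $\varphi_1,\varphi_2\in\mathcal S(\mathbb R^d)$ and $a\in\mathcal S'(\mathbb R^{2d})$, the Schwartz kernel of $A_{a,\mathcal A}^{\varphi_1,\varphi_2}$ is $$k=\hat{\mathcal A}^{-1}\bigl(a*W_{\mathcal A}(\varphi_2,\varphi_1)\bigr)\in\mathcal S'(\mathbb R^{2d}),$$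 that is, $\langle A_{a,\mathcal A}^{\varphi_1,\varphi_2}f,g\rangle=\langle k,g\otimes\bar f\rangle$ for all $f,g\in\mathcal S(\mathbb R^d)$. -/

import Mathlib

open MeasureTheory SchwartzMap
open scoped Matrix ContDiff ENNReal ComplexConjugate

noncomputable section

namespace MetaplecticLocalization

/-! ### Euclidean spaces and the space `L²` -/

/-- The Euclidean space with coordinates indexed by the finite type `ι`. -/
abbrev Euc (ι : Type) [Fintype ι] : Type := EuclideanSpace ℝ ι

/-- `L²(ℝ^ι)`, complex valued, with respect to Lebesgue measure. -/
abbrev LTwo (ι : Type) [Fintype ι] : Type := Lp ℂ 2 (volume : Measure (Euc ι))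

/-- The linear map `x ↦ (x_{e i})_i` that selects the coordinates `e i` of `x`. -/
def selectCoord {ι κ : Type} [Fintype ι] [Fintype κ] (e : ι → κ) : Euc κ →L[ℝ] Euc ι :=
  LinearMap.toContinuousLinearMap
    { toFun := fun x => WithLp.toLp 2 (fun i => x (e i))
      map_add' := fun _ _ => rfl
      map_smul' := fun _ _ => rfl }

/-- The first component `x` of a point `(x, y)`. -/
def fstPart {ι κ : Type} [Fintype ι] [Fintype κ] : Euc (ι ⊕ κ) →L[ℝ] Euc ι :=
  selectCoord Sum.inl

/-- The second component `y` of a point `(x, y)`. -/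
def sndPart {ι κ : Type} [Fintype ι] [Fintype κ] : Euc (ι ⊕ κ) →L[ℝ] Euc κ :=
  selectCoord Sum.inr

theorem norm_le_fst_add_snd {ι κ : Type} [Fintype ι] [Fintype κ] (x : Euc (ι ⊕ κ)) :
    ‖x‖ ≤ ‖fstPart x‖ + ‖sndPart x‖ := by
  have h : ‖x‖ ^ 2 = ‖fstPart x‖ ^ 2 + ‖sndPart x‖ ^ 2 := by
    simp only [EuclideanSpace.norm_sq_eq, Fintype.sum_sum_type]
    rfl
  nlinarith [norm_nonneg x, norm_nonneg (fstPart x), norm_nonneg (sndPart x),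
    mul_nonneg (norm_nonneg (fstPart x)) (norm_nonneg (sndPart x))]

/-! ### Schwartz functions: conjugation, reflection, tensor products -/

/-- Pointwise complex conjugation `f ↦ f̄` on Schwartz functions. -/
def conjS {ι : Type} [Fintype ι] : 𝓢(Euc ι, ℂ) →L⋆[ℂ] 𝓢(Euc ι, ℂ) :=
  mkCLM (𝕜 := ℂ) (𝕜' := ℂ) (σ := starRingEnd ℂ) (fun f x => conj (f x))
    (fun f g x => by simp) (fun a f x => by simp)
    (fun f => (Complex.conjCLE : ℂ →L[ℝ] ℂ).contDiff.comp (f.smooth ⊤))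
    (by
      rintro ⟨k, n⟩
      refine ⟨{(k, n)}, 1, zero_le_one, fun f x => ?_⟩
      have h : ‖iteratedFDeriv ℝ n (fun x => conj (f x)) x‖ = ‖iteratedFDeriv ℝ n f x‖ :=
        LinearIsometryEquiv.norm_iteratedFDeriv_comp_left Complex.conjLIE f x n
      simp only [Finset.sup_singleton, schwartzSeminormFamily_apply, one_mul, h]
      exact le_seminorm ℂ k n f x)

@[simp]
theorem conjS_apply {ι : Type} [Fintype ι] (f : 𝓢(Euc ι, ℂ)) (x : Euc ι) :
    conjS f x = conj (f x) := rfl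

@[simp]
theorem conjS_conjS {ι : Type} [Fintype ι] (f : 𝓢(Euc ι, ℂ)) : conjS (conjS f) = f := by
  ext x; simp

/-- Reflection `f ↦ f(-·)` on Schwartz functions. -/
def reflS {ι : Type} [Fintype ι] : 𝓢(Euc ι, ℂ) →L[ℂ] 𝓢(Euc ι, ℂ) :=
  compCLMOfContinuousLinearEquiv ℂ (ContinuousLinearEquiv.neg ℝ)

@[simp]
theorem reflS_apply {ι : Type} [Fintype ι] (f : 𝓢(Euc ι, ℂ)) (x : Euc ι) :
    reflS f x = f (-x) := rfl

theorem contDiff_tensor {ι κ : Type} [Fintype ι] [Fintype κ]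
    (f : 𝓢(Euc ι, ℂ)) (g : 𝓢(Euc κ, ℂ)) :
    ContDiff ℝ ∞ (fun z : Euc (ι ⊕ κ) => f (fstPart z) * g (sndPart z)) := by
  have hF : ContDiff ℝ ∞ (fun z : Euc (ι ⊕ κ) => f (fstPart z)) :=
    (f.smooth ⊤).comp (fstPart : Euc (ι ⊕ κ) →L[ℝ] Euc ι).contDiff
  have hG : ContDiff ℝ ∞ (fun z : Euc (ι ⊕ κ) => g (sndPart z)) :=
    (g.smooth ⊤).comp (sndPart : Euc (ι ⊕ κ) →L[ℝ] Euc κ).contDiff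
  exact hF.mul hG

theorem tensor_bound {ι κ : Type} [Fintype ι] [Fintype κ] (k n : ℕ) :
    ∃ C : ℝ, 0 ≤ C ∧ ∀ (f : 𝓢(Euc ι, ℂ)) (g : 𝓢(Euc κ, ℂ)) (z : Euc (ι ⊕ κ)),
      ‖z‖ ^ k * ‖iteratedFDeriv ℝ n (fun z => f (fstPart z) * g (sndPart z)) z‖ ≤
        C * ((Finset.Iic (k, n)).sup (schwartzSeminormFamily ℂ (Euc ι) ℂ) f *
          (Finset.Iic (k, n)).sup (schwartzSeminormFamily ℂ (Euc κ) ℂ) g) := by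
  set P : ℝ := ‖(fstPart : Euc (ι ⊕ κ) →L[ℝ] Euc ι)‖ with hP
  set Q : ℝ := ‖(sndPart : Euc (ι ⊕ κ) →L[ℝ] Euc κ)‖ with hQ
  refine ⟨∑ i ∈ Finset.range (n + 1), (n.choose i : ℝ) * (2 ^ k * P ^ i) * (2 ^ k * Q ^ (n - i)),
    by positivity, fun f g z => ?_⟩
  have hz : ‖z‖ ^ k ≤ (1 + ‖fstPart z‖) ^ k * (1 + ‖sndPart z‖) ^ k := by
    rw [← mul_pow]
    refine pow_le_pow_left₀ (norm_nonneg _) ((norm_le_fst_add_snd z).trans ?_) _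
    nlinarith [mul_nonneg (norm_nonneg (fstPart z)) (norm_nonneg (sndPart z))]
  have hF : ContDiff ℝ ∞ (fun z : Euc (ι ⊕ κ) => f (fstPart z)) :=
    (f.smooth ⊤).comp (fstPart : Euc (ι ⊕ κ) →L[ℝ] Euc ι).contDiff
  have hG : ContDiff ℝ ∞ (fun z : Euc (ι ⊕ κ) => g (sndPart z)) :=
    (g.smooth ⊤).comp (sndPart : Euc (ι ⊕ κ) →L[ℝ] Euc κ).contDiff
  have hFi : ∀ i, ‖iteratedFDeriv ℝ i (fun z : Euc (ι ⊕ κ) => f (fstPart z)) z‖ ≤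
      ‖iteratedFDeriv ℝ i f (fstPart z)‖ * P ^ i := by
    intro i
    have h := fstPart.iteratedFDeriv_comp_right (f.smooth ⊤) z (i := i) (by exact_mod_cast le_top)
    have h2 := ContinuousMultilinearMap.norm_compContinuousLinearMap_le
      (iteratedFDeriv ℝ i f (fstPart z))
      (fun _ : Fin i => (fstPart : Euc (ι ⊕ κ) →L[ℝ] Euc ι))
    rw [← h] at h2
    simpa [Function.comp_def] using h2
  have hGi : ∀ i, ‖iteratedFDeriv ℝ i (fun z : Euc (ι ⊕ κ) => g (sndPart z)) z‖ ≤
      ‖iteratedFDeriv ℝ i g (sndPart z)‖ * Q ^ i := by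
    intro i
    have h := sndPart.iteratedFDeriv_comp_right (g.smooth ⊤) z (i := i) (by exact_mod_cast le_top)
    have h2 := ContinuousMultilinearMap.norm_compContinuousLinearMap_le
      (iteratedFDeriv ℝ i g (sndPart z))
      (fun _ : Fin i => (sndPart : Euc (ι ⊕ κ) →L[ℝ] Euc κ))
    rw [← h] at h2
    simpa [Function.comp_def] using h2
  have hmul := norm_iteratedFDeriv_mul_le hF hG z (n := n) (by exact_mod_cast le_top)
  refine (mul_le_mul_of_nonneg_left hmul (by positivity)).trans ?_
  rw [Finset.mul_sum, Finset.sum_mul]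
  refine Finset.sum_le_sum fun i hi => ?_
  have hi' : i ≤ n := Nat.lt_succ_iff.mp (Finset.mem_range.mp hi)
  set Sf := (Finset.Iic (k, n)).sup (schwartzSeminormFamily ℂ (Euc ι) ℂ) f
  set Sg := (Finset.Iic (k, n)).sup (schwartzSeminormFamily ℂ (Euc κ) ℂ) g
  have h1 : (1 + ‖fstPart z‖) ^ k * ‖iteratedFDeriv ℝ i f (fstPart z)‖ ≤ 2 ^ k * Sf :=
    one_add_le_sup_seminorm_apply (𝕜 := ℂ) (m := (k, n)) le_rfl hi' f (fstPart z)
  have h2 : (1 + ‖sndPart z‖) ^ k * ‖iteratedFDeriv ℝ (n - i) g (sndPart z)‖ ≤ 2 ^ k * Sg :=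
    one_add_le_sup_seminorm_apply (𝕜 := ℂ) (m := (k, n)) le_rfl (Nat.sub_le n i) g (sndPart z)
  calc
    _ ≤ ((1 + ‖fstPart z‖) ^ k * (1 + ‖sndPart z‖) ^ k) *
        ((n.choose i : ℝ) * (‖iteratedFDeriv ℝ i f (fstPart z)‖ * P ^ i) *
          (‖iteratedFDeriv ℝ (n - i) g (sndPart z)‖ * Q ^ (n - i))) := by
      gcongr
      · exact hFi i
      · exact hGi (n - i)
    _ = (n.choose i : ℝ) * P ^ i * Q ^ (n - i) *
        (((1 + ‖fstPart z‖) ^ k * ‖iteratedFDeriv ℝ i f (fstPart z)‖) *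
          ((1 + ‖sndPart z‖) ^ k * ‖iteratedFDeriv ℝ (n - i) g (sndPart z)‖)) := by ring
    _ ≤ (n.choose i : ℝ) * P ^ i * Q ^ (n - i) * ((2 ^ k * Sf) * (2 ^ k * Sg)) := by
      gcongr
    _ = _ := by ring

/-- The tensor product `(f ⊗ g)(x, y) = f(x) g(y)`, continuous and linear in the factor `g`. -/
def tensorS {ι κ : Type} [Fintype ι] [Fintype κ] (f : 𝓢(Euc ι, ℂ)) :
    𝓢(Euc κ, ℂ) →L[ℂ] 𝓢(Euc (ι ⊕ κ), ℂ) :=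
  mkCLM (𝕜 := ℂ) (𝕜' := ℂ) (fun g z => f (fstPart z) * g (sndPart z))
    (fun g h z => by simp [mul_add]) (fun a g z => by simp [mul_left_comm])
    (fun g => contDiff_tensor f g)
    (by
      rintro ⟨k, n⟩
      obtain ⟨C, hC, h⟩ := tensor_bound (ι := ι) (κ := κ) k n
      refine ⟨Finset.Iic (k, n),
        C * (Finset.Iic (k, n)).sup (schwartzSeminormFamily ℂ (Euc ι) ℂ) f,
        mul_nonneg hC (apply_nonneg _ _), fun g z => ?_⟩
      rw [mul_assoc]
      exact h f g z)

@[simp]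
theorem tensorS_apply {ι κ : Type} [Fintype ι] [Fintype κ] (f : 𝓢(Euc ι, ℂ))
    (g : 𝓢(Euc κ, ℂ)) (z : Euc (ι ⊕ κ)) :
    tensorS f g z = f (fstPart z) * g (sndPart z) := rfl

/-- The tensor product `f ⊗ g` as a continuous linear map in the factor `f`. -/
def tensorFlipS {ι κ : Type} [Fintype ι] [Fintype κ] (g : 𝓢(Euc κ, ℂ)) :
    𝓢(Euc ι, ℂ) →L[ℂ] 𝓢(Euc (ι ⊕ κ), ℂ) :=
  mkCLM (𝕜 := ℂ) (𝕜' := ℂ) (fun f z => f (fstPart z) * g (sndPart z))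
    (fun f h z => by simp [add_mul]) (fun a f z => by simp [mul_assoc])
    (fun f => contDiff_tensor f g)
    (by
      rintro ⟨k, n⟩
      obtain ⟨C, hC, h⟩ := tensor_bound (ι := ι) (κ := κ) k n
      refine ⟨Finset.Iic (k, n),
        C * (Finset.Iic (k, n)).sup (schwartzSeminormFamily ℂ (Euc κ) ℂ) g,
        mul_nonneg hC (apply_nonneg _ _), fun f z => ?_⟩
      rw [mul_assoc, mul_comm ((Finset.Iic (k, n)).sup (schwartzSeminormFamily ℂ (Euc κ) ℂ) g)]
      exact h f g z)

@[simp]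
theorem tensorFlipS_eq {ι κ : Type} [Fintype ι] [Fintype κ] (f : 𝓢(Euc ι, ℂ))
    (g : 𝓢(Euc κ, ℂ)) : tensorFlipS g f = tensorS f g := rfl

/-! ### Tempered distributions: sesquilinear bracket and convolution -/

/-- The bracket `⟨u, φ⟩`, conjugate-linear in `φ`, that extends the inner product
`⟨f, g⟩ = ∫ f ḡ`. -/
def bracket {ι : Type} [Fintype ι] (u : 𝓢'(Euc ι, ℂ)) (φ : 𝓢(Euc ι, ℂ)) : ℂ :=
  u (conjS φ)

/-- The convolution `u * φ ∈ 𝓢'` of `u ∈ 𝓢'` and `φ ∈ 𝓢`: `(u * φ)(ψ) = u(φ(-·) * ψ)`. -/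
def convDist {ι : Type} [Fintype ι] (u : 𝓢'(Euc ι, ℂ)) (φ : 𝓢(Euc ι, ℂ)) : 𝓢'(Euc ι, ℂ) :=
  PointwiseConvergenceCLM.precomp ℂ
    (SchwartzMap.convolution (ContinuousLinearMap.mul ℂ ℂ) (reflS φ)) u

/-! ### Schrödinger representation and metaplectic operators -/

theorem memLp_schrodinger {ι : Type} [Fintype ι] (x ξ : Euc ι) (τ : ℝ) (f : LTwo ι) :
    MemLp (fun t : Euc ι =>
      Complex.exp (2 * Real.pi * Complex.I * (τ : ℂ)) *
        Complex.exp (-(Real.pi * Complex.I * ((inner ℝ ξ x : ℝ) : ℂ))) *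
        Complex.exp (2 * Real.pi * Complex.I * ((inner ℝ ξ t : ℝ) : ℂ)) * f (t - x)) 2 volume := by
  have h : MemLp (fun t : Euc ι => f (t - x)) 2 volume :=
    (Lp.memLp f).comp_measurePreserving (measurePreserving_sub_right volume x)
  refine h.mono ((Continuous.aestronglyMeasurable (by fun_prop)).mul h.1)
    (Filter.Eventually.of_forall fun t => le_of_eq ?_)
  simp [Complex.norm_exp]

/-- The Schrödinger representation of the Heisenberg group on `L²`, at `z = (x, ξ)`:
`ρ(x, ξ; τ) f(t) = e^{2πiτ} e^{-πi ξ·x} e^{2πi ξ·t} f(t - x)`. -/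
def schrodinger {ι : Type} [Fintype ι] (z : Euc (ι ⊕ ι)) (τ : ℝ) (f : LTwo ι) : LTwo ι :=
  (memLp_schrodinger (fstPart z) (sndPart z) τ f).toLp

/-- The action of a matrix on phase space. -/
def matAct {ι : Type} [Fintype ι] (A : Matrix (ι ⊕ ι) (ι ⊕ ι) ℝ) (z : Euc (ι ⊕ ι)) :
    Euc (ι ⊕ ι) :=
  WithLp.toLp 2 (A *ᵥ WithLp.ofLp z)

/-- The unitary operator `U` on `L²` is a metaplectic operator with projection the symplectic
matrix `A`: `U ρ(z; τ) U⁻¹ = ρ(A z; τ)` for all `z` and `τ`. -/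
def IsMetaplectic {ι : Type} [Fintype ι] [DecidableEq ι] (A : Matrix.symplecticGroup ι ℝ)
    (U : LTwo ι ≃ₗᵢ[ℂ] LTwo ι) : Prop :=
  ∀ (z : Euc (ι ⊕ ι)) (τ : ℝ) (f : LTwo ι),
    U (schrodinger z τ (U.symm f)) = schrodinger (matAct A.1 z) τ f

/-- `T : 𝓢 → 𝓢` is the restriction to Schwartz functions of the operator `U` on `L²`. -/
def IsSchwartzRestriction {ι : Type} [Fintype ι] (U : LTwo ι ≃ₗᵢ[ℂ] LTwo ι)
    (T : 𝓢(Euc ι, ℂ) →L[ℂ] 𝓢(Euc ι, ℂ)) : Prop :=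
  ∀ f : 𝓢(Euc ι, ℂ), (T f).toLp 2 = U (f.toLp 2)

open scoped Classical in
/-- The restriction of `U` to a continuous operator on Schwartz functions
(unique when it exists; `0` when `U` does not restrict). -/
def onSchwartz {ι : Type} [Fintype ι] (U : LTwo ι ≃ₗᵢ[ℂ] LTwo ι) :
    𝓢(Euc ι, ℂ) →L[ℂ] 𝓢(Euc ι, ℂ) :=
  if h : ∃ T, IsSchwartzRestriction U T then h.choose else 0

theorem IsSchwartzRestriction.eq_onSchwartz {ι : Type} [Fintype ι] {U : LTwo ι ≃ₗᵢ[ℂ] LTwo ι}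
    {T : 𝓢(Euc ι, ℂ) →L[ℂ] 𝓢(Euc ι, ℂ)} (hT : IsSchwartzRestriction U T) :
    onSchwartz U = T := by
  have h : ∃ T, IsSchwartzRestriction U T := ⟨T, hT⟩
  have e : onSchwartz U = h.choose := by simp only [onSchwartz, dif_pos h]
  rw [e]
  ext1 f
  exact injective_toLp 2 volume ((h.choose_spec f).trans (hT f).symm)

/-- The action of the unitary operator `U` on tempered distributions:
`⟨U u, φ⟩ = ⟨u, U⁻¹ φ⟩` for Schwartz functions `φ`. -/
def onDist {ι : Type} [Fintype ι] (U : LTwo ι ≃ₗᵢ[ℂ] LTwo ι) :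
    𝓢'(Euc ι, ℂ) →L[ℂ] 𝓢'(Euc ι, ℂ) :=
  PointwiseConvergenceCLM.precomp ℂ
    ((conjS.comp ((onSchwartz U.symm).comp conjS) : 𝓢(Euc ι, ℂ) →L[ℂ] 𝓢(Euc ι, ℂ)))

theorem bracket_onDist {ι : Type} [Fintype ι] (U : LTwo ι ≃ₗᵢ[ℂ] LTwo ι) (u : 𝓢'(Euc ι, ℂ))
    (φ : 𝓢(Euc ι, ℂ)) : bracket (onDist U u) φ = bracket u (onSchwartz U.symm φ) := by
  change u (conjS (onSchwartz U.symm (conjS (conjS φ)))) = _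
  rw [conjS_conjS]
  rfl

/-! ### Metaplectic Wigner distributions, pseudodifferential and localization operators -/

/-- The metaplectic Wigner distribution `W(f, g) = U (f ⊗ ḡ)` of Schwartz functions. -/
def wigner {ι : Type} [Fintype ι] (U : LTwo (ι ⊕ ι) ≃ₗᵢ[ℂ] LTwo (ι ⊕ ι))
    (f g : 𝓢(Euc ι, ℂ)) : 𝓢(Euc (ι ⊕ ι), ℂ) :=
  onSchwartz U (tensorS f (conjS g))

/-- For fixed `f`, the linear map `ψ ↦ conj (W(ψ̄, f))`. -/
def wignerConj {ι : Type} [Fintype ι] (U : LTwo (ι ⊕ ι) ≃ₗᵢ[ℂ] LTwo (ι ⊕ ι))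
    (f : 𝓢(Euc ι, ℂ)) : 𝓢(Euc ι, ℂ) →L[ℂ] 𝓢(Euc (ι ⊕ ι), ℂ) :=
  conjS.comp (((onSchwartz U).comp (tensorFlipS (conjS f))).comp conjS)

theorem wignerConj_apply {ι : Type} [Fintype ι] (U : LTwo (ι ⊕ ι) ≃ₗᵢ[ℂ] LTwo (ι ⊕ ι))
    (f ψ : 𝓢(Euc ι, ℂ)) : wignerConj U f ψ = conjS (wigner U (conjS ψ) f) := rfl

/-- For fixed `ψ`, the linear map `f ↦ conj (W(ψ̄, f))`. -/
def wignerConjFlip {ι : Type} [Fintype ι] (U : LTwo (ι ⊕ ι) ≃ₗᵢ[ℂ] LTwo (ι ⊕ ι))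
    (ψ : 𝓢(Euc ι, ℂ)) : 𝓢(Euc ι, ℂ) →L[ℂ] 𝓢(Euc (ι ⊕ ι), ℂ) :=
  conjS.comp (((onSchwartz U).comp (tensorS (conjS ψ))).comp conjS)

theorem wignerConjFlip_apply {ι : Type} [Fintype ι] (U : LTwo (ι ⊕ ι) ≃ₗᵢ[ℂ] LTwo (ι ⊕ ι))
    (f ψ : 𝓢(Euc ι, ℂ)) : wignerConjFlip U ψ f = wignerConj U f ψ := rfl

/-- The metaplectic pseudodifferential operator with symbol `a`: the continuous linear operator
`𝓢 → 𝓢'` with `⟨Op(a) f, g⟩ = ⟨a, W(g, f)⟩`. -/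
def metaplecticOp {ι : Type} [Fintype ι] (U : LTwo (ι ⊕ ι) ≃ₗᵢ[ℂ] LTwo (ι ⊕ ι))
    (a : 𝓢'(Euc (ι ⊕ ι), ℂ)) : 𝓢(Euc ι, ℂ) →L[ℂ] 𝓢'(Euc ι, ℂ) where
  toFun f := PointwiseConvergenceCLM.precomp ℂ (wignerConj U f) a
  map_add' f g := by
    ext ψ
    change a (wignerConj U (f + g) ψ) = a (wignerConj U f ψ) + a (wignerConj U g ψ)
    simp only [← wignerConjFlip_apply, map_add]
  map_smul' c f := by
    ext ψ
    change a (wignerConj U (c • f) ψ) = c • a (wignerConj U f ψ)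
    simp only [← wignerConjFlip_apply, map_smul]
  cont := PointwiseConvergenceCLM.continuous_of_continuous_eval fun ψ =>
    a.continuous.comp (wignerConjFlip U ψ).continuous

theorem bracket_metaplecticOp {ι : Type} [Fintype ι]
    (U : LTwo (ι ⊕ ι) ≃ₗᵢ[ℂ] LTwo (ι ⊕ ι)) (a : 𝓢'(Euc (ι ⊕ ι), ℂ)) (f g : 𝓢(Euc ι, ℂ)) :
    bracket (metaplecticOp U a f) g = bracket a (wigner U g f) := by
  change a (conjS (wigner U (conjS (conjS g)) f)) = _
  rw [conjS_conjS]
  rfl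

/-- The localization operator `Op(a * W(φ₂, φ₁))` attached to the metaplectic operator `U`, the
symbol `a` and the windows `φ₁, φ₂`. -/
def localizationOp {ι : Type} [Fintype ι] (U : LTwo (ι ⊕ ι) ≃ₗᵢ[ℂ] LTwo (ι ⊕ ι))
    (a : 𝓢'(Euc (ι ⊕ ι), ℂ)) (φ₁ φ₂ : 𝓢(Euc ι, ℂ)) : 𝓢(Euc ι, ℂ) →L[ℂ] 𝓢'(Euc ι, ℂ) :=
  metaplecticOp U (convDist a (wigner U φ₂ φ₁))

/-- `k ∈ 𝓢'` is the Schwartz kernel of `T : 𝓢 → 𝓢'`: `⟨T f, g⟩ = ⟨k, g ⊗ f̄⟩`. -/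
def IsSchwartzKernel {ι : Type} [Fintype ι] (T : 𝓢(Euc ι, ℂ) →L[ℂ] 𝓢'(Euc ι, ℂ))
    (k : 𝓢'(Euc (ι ⊕ ι), ℂ)) : Prop :=
  ∀ f g : 𝓢(Euc ι, ℂ), bracket (T f) g = bracket k (tensorS g (conjS f))

end MetaplecticLocalization

end

open MetaplecticLocalization

/-! ### Partial Fourier transform on Schwartz functions of two variables -/

noncomputable section PartialFourier

open scoped FourierTransform RealInnerProductSpace

namespace SchwartzMap


/-! The kernel formula is formal: both brackets unfold to `⟨b, U (g ⊗ f̄)⟩` with `b = a * W(φ₂,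
φ₁)`. The substance lies in showing that `U` and `U⁻¹` preserve Schwartz functions continuously.

Write `ρ(z)` for `ρ(z; 0)`. For a Schwartz function `G` on phase space, the operator `∫ G(z) ρ(z)
dz` has a Schwartz integral kernel, obtained from `G` by a Fourier transform in the second variable
and a linear change of variables (`integral_mul_shift_eq`). Both steps are invertible, so every
Schwartz kernel arises in this way (`shiftKernel_shiftSymbol`). In particular some `G`, depending
continuously on `f`, gives the rank one operator `g ↦ ⟨g, φ⟩ f`.

Conjugation by `U` replaces `ρ(z)` by `ρ(L z)`, with `L` the linear automorphism of phase space. A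
change of variables turns the result into `c ∫ G(L⁻¹ z) ρ(z) dz`, again an operator with Schwartz
kernel. Evaluated at a Schwartz function `χ`, this says that `⟨U⁻¹ χ, φ⟩ U f` is a Schwartz function
depending continuously on `f` (`exists_inner_moveShifts`). Density provides `χ` and `φ` with nonzero
scalar factor, and division by it gives the restriction of `U`. The inverse is treated with `L⁻¹`.
All operator integrals are read weakly, through inner products. -/

theorem exists_seminorm_comp {X Y : Type*} [AddCommGroup X] [Module ℝ X] [TopologicalSpace X]
    [AddCommGroup Y] [Module ℝ Y] [TopologicalSpace Y] {q : Seminorm ℝ Y} (hq : Continuous q)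
    (D : X →L[ℝ] Y) : ∃ q' : Seminorm ℝ X, Continuous q' ∧ ∀ x, q' x = q (D x) :=
  ⟨q.comp D.toLinearMap, hq.comp D.continuous, fun _ => rfl⟩

section Slices

variable {E F V : Type} [NormedAddCommGroup E] [NormedSpace ℝ E]
  [NormedAddCommGroup F] [NormedSpace ℝ F] [NormedAddCommGroup V] [NormedSpace ℝ V]

/-- A Schwartz function on a product decays in the second variable, with a bound that may be
weighted by any power of the first variable. -/
theorem exists_slice_bound (l N : ℕ) :
    ∃ q : Seminorm ℝ 𝓢(E × F, V), Continuous q ∧ ∀ (K : 𝓢(E × F, V)) (x : E) (ξ : F),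
      ‖x‖ ^ l * ‖K (x, ξ)‖ ≤ (1 + ‖ξ‖) ^ (-(N : ℝ)) * q K := by
  refine ⟨(2 : NNReal) ^ (l + N) •
    (Finset.Iic (l + N, 0)).sup (schwartzSeminormFamily ℝ (E × F) V), ?_, fun K x ξ => ?_⟩
  · have h : Continuous ((Finset.Iic (l + N, 0)).sup (schwartzSeminormFamily ℝ (E × F) V) :
        Seminorm ℝ 𝓢(E × F, V)) :=
      Seminorm.continuous_finsetSup fun i _ =>
        (schwartz_withSeminorms ℝ (E × F) V).continuous_seminorm i
    exact h.const_smul _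
  · have h := one_add_le_sup_seminorm_apply (𝕜 := ℝ) (m := (l + N, 0)) (k := l + N) (n := 0)
      le_rfl le_rfl K (x, ξ)
    rw [norm_iteratedFDeriv_zero] at h
    have hx : ‖x‖ ≤ 1 + ‖(x, ξ)‖ := (norm_fst_le (x, ξ)).trans (by linarith)
    have hξ : 1 + ‖ξ‖ ≤ 1 + ‖(x, ξ)‖ := by linarith [norm_snd_le (x, ξ)]
    rw [Real.rpow_neg (by positivity), ← div_eq_inv_mul, le_div_iff₀ (by positivity),
      Real.rpow_natCast]
    calc ‖x‖ ^ l * ‖K (x, ξ)‖ * (1 + ‖ξ‖) ^ N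
        ≤ (1 + ‖(x, ξ)‖) ^ l * ‖K (x, ξ)‖ * (1 + ‖(x, ξ)‖) ^ N := by gcongr
      _ = (1 + ‖(x, ξ)‖) ^ (l + N) * ‖K (x, ξ)‖ := by ring
      _ ≤ _ := h

theorem continuous_slice (K : 𝓢(E × F, V)) (x : E) : Continuous fun ξ => K (x, ξ) :=
  K.continuous.comp (by fun_prop)

/-- The derivative of a Schwartz function on a product in the second variable. -/
def fderivSnd : 𝓢(E × F, V) →L[ℝ] 𝓢(E × F, F →L[ℝ] V) :=
  (postcompCLM ((ContinuousLinearMap.compL ℝ F (E × F) V).flip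
    (ContinuousLinearMap.inr ℝ E F))).comp (fderivCLM ℝ (E × F) V)

theorem hasFDerivAt_slice (K : 𝓢(E × F, V)) (x : E) (ξ : F) :
    HasFDerivAt (fun ξ => K (x, ξ)) (fderivSnd K (x, ξ)) ξ :=
  (K.hasFDerivAt (x, ξ)).comp ξ (hasFDerivAt_prodMk_right x ξ)

theorem integrable_slice {F : Type} [NormedAddCommGroup F] [InnerProductSpace ℝ F]
    [FiniteDimensional ℝ F] [MeasurableSpace F] [BorelSpace F] (K : 𝓢(E × F, V)) (x : E) :
    Integrable fun ξ => K (x, ξ) := by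
  obtain ⟨q, -, hq⟩ := exists_slice_bound (E := E) (F := F) (V := V) 0
    (volume : Measure F).integrablePower
  have hint := ((volume : Measure F).integrable_pow_neg_integrablePower).mul_const (q K)
  refine hint.mono' (continuous_slice K x).aestronglyMeasurable
    (Filter.Eventually.of_forall fun ξ => ?_)
  simpa using hq K x ξ

end Slices

variable {E F V : Type} [NormedAddCommGroup E] [NormedSpace ℝ E]
  [NormedAddCommGroup F] [InnerProductSpace ℝ F] [FiniteDimensional ℝ F]
  [MeasurableSpace F] [BorelSpace F]
  [NormedAddCommGroup V] [NormedSpace ℂ V]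

/-- The Fourier transform in the second variable, as a function. -/
def partialFourierFun (K : 𝓢(E × F, V)) (p : E × F) : V := 𝓕 (fun ξ => K (p.1, ξ)) p.2

theorem partialFourierFun_eq (K : 𝓢(E × F, V)) (p : E × F) :
    partialFourierFun K p = ∫ ξ, Real.fourierChar (-⟪ξ, p.2⟫) • K (p.1, ξ) :=
  Real.fourier_eq _ _

theorem exists_partialFourierFun_bound (l : ℕ) :
    ∃ q : Seminorm ℝ 𝓢(E × F, V), Continuous q ∧ ∀ (K : 𝓢(E × F, V)) (p : E × F),
      ‖p.1‖ ^ l * ‖partialFourierFun K p‖ ≤ q K := by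
  obtain ⟨q, hqc, hq⟩ := exists_slice_bound (E := E) (F := F) (V := V) l
    (volume : Measure F).integrablePower
  have hint := (volume : Measure F).integrable_pow_neg_integrablePower
  -- The total mass of the dominating weight. It scales `q` as an element of `ℝ≥0`, hence the
  -- `toNNReal` below.
  set c : ℝ := ∫ ξ : F, (1 + ‖ξ‖) ^ (-((volume : Measure F).integrablePower : ℝ)) with hc
  have hc0 : 0 ≤ c := integral_nonneg fun ξ => by positivity
  refine ⟨c.toNNReal • q, hqc.const_smul _, fun K p => ?_⟩
  rw [partialFourierFun_eq]
  calc ‖p.1‖ ^ l * ‖∫ ξ, Real.fourierChar (-⟪ξ, p.2⟫) • K (p.1, ξ)‖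
      ≤ ‖p.1‖ ^ l * ∫ ξ, ‖K (p.1, ξ)‖ := by
        gcongr
        refine (norm_integral_le_integral_norm _).trans (le_of_eq ?_)
        simp only [Circle.norm_smul]
    _ = ∫ ξ, ‖p.1‖ ^ l * ‖K (p.1, ξ)‖ := by rw [integral_const_mul]
    _ ≤ ∫ ξ : F, (1 + ‖ξ‖) ^ (-((volume : Measure F).integrablePower : ℝ)) * q K :=
        integral_mono ((integrable_slice K p.1).norm.const_mul _) (hint.mul_const _)
          fun ξ => hq K p.1 ξ
    _ = (c.toNNReal • q) K := by
        rw [integral_mul_const, smul_apply, NNReal.smul_def, Real.coe_toNNReal _ hc0,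
          smul_eq_mul]

/-- The Schwartz function whose partial Fourier transform is the derivative of the partial
Fourier transform of `K`. -/
def partialFourierDeriv : 𝓢(E × F, V) →L[ℝ] 𝓢(E × F, E × F →L[ℝ] V) :=
  (postcompCLM ((ContinuousLinearMap.compL ℝ (E × F) (E × F) V).flip
    ((ContinuousLinearMap.inl ℝ E F).comp (ContinuousLinearMap.fst ℝ E F)))).comp
      (fderivCLM ℝ (E × F) V) +
  ((-(2 * Real.pi * Complex.I) : ℂ) • (ContinuousLinearMap.id ℝ _)).comp (smulRightCLM ℝ V
    ((innerSL ℝ).bilinearComp (ContinuousLinearMap.snd ℝ E F) (ContinuousLinearMap.snd ℝ E F)))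

omit [FiniteDimensional ℝ F] [MeasurableSpace F] [BorelSpace F] in
theorem partialFourierDeriv_apply (K : 𝓢(E × F, V)) (p : E × F) :
    partialFourierDeriv K p = (fderiv ℝ K p).comp
      ((ContinuousLinearMap.inl ℝ E F).comp (ContinuousLinearMap.fst ℝ E F)) +
      (-(2 * Real.pi * Complex.I) : ℂ) •
        ((innerSL ℝ p.2).comp (ContinuousLinearMap.snd ℝ E F)).smulRight (K p) := by
  rfl

omit [FiniteDimensional ℝ F] [MeasurableSpace F] [BorelSpace F] in
theorem hasFDerivAt_partialFourier_integrand (K : 𝓢(E × F, V)) (ξ : F) (p : E × F) :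
    HasFDerivAt (fun p : E × F => Real.fourierChar (-⟪ξ, p.2⟫) • K (p.1, ξ))
      (Real.fourierChar (-⟪ξ, p.2⟫) • partialFourierDeriv K (p.1, ξ)) p := by
  have h1 := (VectorFourier.hasFDerivAt_fourierChar_smul (innerSL ℝ) (fun _ : F => (1 : ℂ)) ξ
    p.2).comp p (hasFDerivAt_snd (𝕜 := ℝ) (p := p))
  have h2 : HasFDerivAt (fun p : E × F => K (p.1, ξ))
      ((fderiv ℝ K (p.1, ξ)).comp
        ((ContinuousLinearMap.inl ℝ E F).comp (ContinuousLinearMap.fst ℝ E F))) p := by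
    refine (K.hasFDerivAt (p.1, ξ)).comp p ?_
    refine HasFDerivAt.congr_fderiv (hasFDerivAt_fst.prodMk (hasFDerivAt_const ξ p)) ?_
    ext v <;> simp
  have h3 := h1.smul h2
  simp only [Function.comp_def, Circle.smul_def, smul_eq_mul, mul_one] at h3
  refine HasFDerivAt.congr_fderiv h3 ?_
  rw [partialFourierDeriv_apply]
  ext v
  · simp [Circle.smul_def, innerSL_apply_apply ℝ]
  · simp [Circle.smul_def, smul_smul, innerSL_apply_apply ℝ]
    rw [← Complex.coe_smul, smul_smul]
    congr 1
    ring

/-- Differentiation under the integral sign, dominated by the slice bound. The derivative is again a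
partial Fourier transform of a Schwartz function, now with values in `E × F →L[ℝ] V`. This is why
`V` is arbitrary: the inductions on the order of differentiation change the target space. -/
theorem hasFDerivAt_partialFourierFun (K : 𝓢(E × F, V)) (p : E × F) :
    HasFDerivAt (partialFourierFun K)
      (partialFourierFun (V := E × F →L[ℝ] V) (partialFourierDeriv K) p) p := by
  rw [funext (partialFourierFun_eq K), partialFourierFun_eq]
  obtain ⟨q, -, hq⟩ := exists_slice_bound (E := E) (F := F) (V := E × F →L[ℝ] V) 0
    (volume : Measure F).integrablePower
  have hint := (volume : Measure F).integrable_pow_neg_integrablePower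
  refine hasFDerivAt_integral_of_dominated_of_fderiv_le Filter.univ_mem
    (F := fun p ξ => Real.fourierChar (-⟪ξ, p.2⟫) • K (p.1, ξ))
    (F' := fun p ξ => Real.fourierChar (-⟪ξ, p.2⟫) • partialFourierDeriv K (p.1, ξ))
    (bound := fun ξ => (1 + ‖ξ‖) ^ (-((volume : Measure F).integrablePower : ℝ)) *
      q (partialFourierDeriv K)) (Filter.Eventually.of_forall fun p => ?_) ?_ ?_
    (Filter.Eventually.of_forall fun ξ p _ => ?_) (hint.mul_const _)
    (Filter.Eventually.of_forall fun ξ p _ => hasFDerivAt_partialFourier_integrand K ξ p)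
  · exact Continuous.aestronglyMeasurable (by have := continuous_slice K p.1; fun_prop)
  · refine (integrable_slice K p.1).mono
      (Continuous.aestronglyMeasurable (by have := continuous_slice K p.1; fun_prop))
      (Filter.Eventually.of_forall fun ξ => by simp only [Circle.norm_smul, le_refl])
  · exact Continuous.aestronglyMeasurable
      (by have := continuous_slice (V := E × F →L[ℝ] V) (partialFourierDeriv K) p.1; fun_prop)
  · simpa only [Circle.smul_def, norm_smul, Circle.norm_coe, pow_zero, one_mul] using
      hq (partialFourierDeriv K) p.1 ξ

theorem contDiff_partialFourierFun (K : 𝓢(E × F, V)) : ContDiff ℝ ∞ (partialFourierFun K) := by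
  refine contDiff_infty.2 fun n => ?_
  induction n generalizing V with
  | zero =>
    exact contDiff_zero.2 (continuous_iff_continuousAt.2 fun p =>
      (hasFDerivAt_partialFourierFun K p).continuousAt)
  | succ n ih =>
    exact contDiff_succ_iff_hasFDerivAt.2 ⟨_, ih (V := E × F →L[ℝ] V) (partialFourierDeriv K),
      hasFDerivAt_partialFourierFun K⟩

theorem norm_partialFourierFun_fderivSnd (K : 𝓢(E × F, V)) (p : E × F) :
    ‖partialFourierFun (fderivSnd K) p‖ = 2 * Real.pi * ‖p.2‖ * ‖partialFourierFun K p‖ := by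
  have hd : (fun ξ => fderivSnd K (p.1, ξ)) = fderiv ℝ fun ξ => K (p.1, ξ) :=
    funext fun ξ => (hasFDerivAt_slice K p.1 ξ).fderiv.symm
  have h := Real.fourier_fderiv (integrable_slice K p.1)
    (fun ξ => (hasFDerivAt_slice K p.1 ξ).differentiableAt)
    (hd ▸ integrable_slice (fderivSnd K) p.1)
  rw [partialFourierFun, hd, h, VectorFourier.norm_fourierSMulRight, partialFourierFun,
    neg_apply, norm_neg, innerSL_apply_norm]

/-- Each power of the frequency is traded for one derivative of `K` in the second variable. The
factor `2π` gained is at least `1` and can be dropped. -/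
theorem exists_snd_bound (l k : ℕ) :
    ∃ q : Seminorm ℝ 𝓢(E × F, V), Continuous q ∧ ∀ (K : 𝓢(E × F, V)) (p : E × F),
      ‖p.1‖ ^ l * (‖p.2‖ ^ k * ‖partialFourierFun K p‖) ≤ q K := by
  induction k generalizing V with
  | zero => simpa using exists_partialFourierFun_bound (E := E) (F := F) (V := V) l
  | succ k ih =>
    obtain ⟨q, hqc, hq⟩ := ih (V := F →L[ℝ] V)
    refine ⟨q.comp fderivSnd.toLinearMap, hqc.comp fderivSnd.continuous, fun K p => ?_⟩
    refine le_trans ?_ (hq (fderivSnd K) p)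
    rw [norm_partialFourierFun_fderivSnd, pow_succ]
    have h1 : 1 ≤ 2 * Real.pi := by linarith [Real.pi_gt_three]
    have : 0 ≤ ‖p.1‖ ^ l * (‖p.2‖ ^ k * ‖p.2‖ * ‖partialFourierFun K p‖) := by positivity
    nlinarith

theorem exists_iteratedFDeriv_partialFourierFun_bound (k n : ℕ) :
    ∃ q : Seminorm ℝ 𝓢(E × F, V), Continuous q ∧ ∀ (K : 𝓢(E × F, V)) (p : E × F),
      ‖p‖ ^ k * ‖iteratedFDeriv ℝ n (partialFourierFun K) p‖ ≤ q K := by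
  induction n generalizing V with
  | zero =>
    obtain ⟨q₁, hqc₁, hq₁⟩ := exists_snd_bound (E := E) (F := F) (V := V) k 0
    obtain ⟨q₂, hqc₂, hq₂⟩ := exists_snd_bound (E := E) (F := F) (V := V) 0 k
    refine ⟨q₁ + q₂, hqc₁.add hqc₂, fun K p => ?_⟩
    have h₁ := hq₁ K p
    have h₂ := hq₂ K p
    rw [pow_zero, one_mul] at h₁ h₂
    rw [norm_iteratedFDeriv_zero, add_apply]
    -- The norm on the product is the maximum, so the weight is a power of one component only. The
    -- sum of the two seminorms covers both cases.
    rcases max_choice ‖p.1‖ ‖p.2‖ with h | h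
    · rw [Prod.norm_def, h]
      exact h₁.trans (le_add_of_nonneg_right (apply_nonneg q₂ K))
    · rw [Prod.norm_def, h]
      exact h₂.trans (le_add_of_nonneg_left (apply_nonneg q₁ K))
  | succ n ih =>
    obtain ⟨q, hqc, hq⟩ := ih (V := E × F →L[ℝ] V)
    obtain ⟨q', hqc', hq'⟩ :=
      exists_seminorm_comp hqc (partialFourierDeriv (E := E) (F := F) (V := V))
    refine ⟨q', hqc', fun K p => ?_⟩
    have hd : fderiv ℝ (partialFourierFun K) =
        partialFourierFun (V := E × F →L[ℝ] V) (partialFourierDeriv K) :=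
      funext fun p => (hasFDerivAt_partialFourierFun K p).fderiv
    rw [← norm_iteratedFDeriv_fderiv, hd, hq']
    exact hq _ p

/-- The Fourier transform in the second variable on Schwartz functions on a product. -/
def partialFourier : 𝓢(E × F, V) →L[ℝ] 𝓢(E × F, V) :=
  mkCLM (𝕜 := ℝ) (𝕜' := ℝ) partialFourierFun
    (fun K L p => by
      simp only [partialFourierFun_eq, add_apply, smul_add]
      refine integral_add ?_ ?_
      · exact (Real.fourierIntegral_convergent_iff p.2).2 (integrable_slice K p.1)
      · exact (Real.fourierIntegral_convergent_iff p.2).2 (integrable_slice L p.1))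
    (fun a K p => by
      simp only [partialFourierFun_eq, smul_apply, smul_comm _ a]
      exact integral_smul a _)
    contDiff_partialFourierFun
    (by
      rintro ⟨k, n⟩
      obtain ⟨q, hqc, hq⟩ :=
        exists_iteratedFDeriv_partialFourierFun_bound (E := E) (F := F) (V := V) k n
      obtain ⟨s, C, -, hC⟩ :=
        Seminorm.bound_of_continuous (schwartz_withSeminorms ℝ (E × F) V) q hqc
      exact ⟨s, C, C.2, fun K p => (hq K p).trans (hC K)⟩)

theorem partialFourier_apply (K : 𝓢(E × F, V)) (p : E × F) :
    partialFourier K p = 𝓕 (fun ξ => K (p.1, ξ)) p.2 := rfl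

end SchwartzMap
end PartialFourier

/-! ### Integrated phase space shifts and their kernels -/

noncomputable section PhaseSpaceShifts

open scoped FourierTransform RealInnerProductSpace

namespace SchwartzMap

variable {E : Type} [NormedAddCommGroup E] [InnerProductSpace ℝ E] [FiniteDimensional ℝ E]
  [MeasurableSpace E] [BorelSpace E]

theorem partialFourier_partialFourier_neg (H : 𝓢(E × E, ℂ)) (x y : E) :
    partialFourier (partialFourier H) (x, -y) = H (x, y) := by
  have h1 : (fun ξ => partialFourier H (x, ξ)) = 𝓕 fun ξ => H (x, ξ) := rfl
  rw [partialFourier_apply, h1, ← Real.fourierInv_eq_fourier_neg]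
  exact congrFun ((continuous_slice H x).fourierInv_fourier_eq (integrable_slice H x)
    (h1 ▸ integrable_slice (partialFourier H) x)) y

omit [FiniteDimensional ℝ E] [MeasurableSpace E] [BorelSpace E] in
theorem exists_fst_bound (K : 𝓢(E × E, ℂ)) (N : ℕ) :
    ∃ C : ℝ, ∀ x y : E, ‖K (x, y)‖ ≤ (1 + ‖x‖) ^ (-(N : ℝ)) * C := by
  obtain ⟨q, -, hq⟩ := exists_slice_bound (E := E) (F := E) (V := ℂ) 0 N
  refine ⟨q (compCLMOfContinuousLinearEquiv ℝ (ContinuousLinearEquiv.prodComm ℝ E E) K),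
    fun x y => ?_⟩
  simpa using hq (compCLMOfContinuousLinearEquiv ℝ (ContinuousLinearEquiv.prodComm ℝ E E) K) y x

/-- The linear change of variables `(t, s) ↦ (t - s, -(t + s) / 2)`. -/
def kernelEquiv : (E × E) ≃L[ℝ] (E × E) :=
  LinearEquiv.toContinuousLinearEquiv
    { toFun := fun p => (p.1 - p.2, -((1 / 2 : ℝ) • (p.1 + p.2)))
      invFun := fun p => ((1 / 2 : ℝ) • p.1 - p.2, -((1 / 2 : ℝ) • p.1) - p.2)
      map_add' := fun p q => by ext <;> simp only [Prod.fst_add, Prod.snd_add] <;> module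
      map_smul' := fun c p => by
        ext <;> simp only [Prod.smul_fst, Prod.smul_snd, RingHom.id_apply] <;> module
      left_inv := fun p => by ext <;> simp only <;> module
      right_inv := fun p => by ext <;> simp only <;> module }

/-- The integral kernel of the operator `∫ G(x, ξ) ρ(x, ξ) dx dξ`. -/
def shiftKernel : 𝓢(E × E, ℂ) →L[ℝ] 𝓢(E × E, ℂ) :=
  (compCLMOfContinuousLinearEquiv ℝ kernelEquiv).comp partialFourier

theorem shiftKernel_apply (G : 𝓢(E × E, ℂ)) (t s : E) :
    shiftKernel G (t, s) = partialFourier G (t - s, -((1 / 2 : ℝ) • (t + s))) := rfl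

/-- The function whose `shiftKernel` is `K`. -/
def shiftSymbol : 𝓢(E × E, ℂ) →L[ℝ] 𝓢(E × E, ℂ) :=
  partialFourier.comp ((compCLMOfContinuousLinearEquiv ℝ
    ((ContinuousLinearEquiv.refl ℝ E).prodCongr (ContinuousLinearEquiv.neg ℝ))).comp
      (compCLMOfContinuousLinearEquiv ℝ kernelEquiv.symm))

/-- By Fourier inversion, applying the partial transform twice reflects the second variable. The
sign change built into `shiftSymbol` compensates for this. -/
theorem shiftKernel_shiftSymbol (K : 𝓢(E × E, ℂ)) : shiftKernel (shiftSymbol K) = K := by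
  ext p
  rw [← Prod.mk.eta (p := p), shiftKernel_apply]
  refine (partialFourier_partialFourier_neg _ _ _).trans ?_
  exact congrArg K (kernelEquiv.symm_apply_apply p)

/-- The phase of the Schrödinger representation at `(x, ξ)`. -/
def shiftPhase (x ξ t : E) : ℂ :=
  Complex.exp (-(Real.pi * Complex.I * ((⟪ξ, x⟫ : ℝ) : ℂ))) *
    Complex.exp (2 * Real.pi * Complex.I * ((⟪ξ, t⟫ : ℝ) : ℂ))

omit [FiniteDimensional ℝ E] [MeasurableSpace E] [BorelSpace E] in
theorem norm_shiftPhase (x ξ t : E) : ‖shiftPhase x ξ t‖ = 1 := by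
  simp [shiftPhase, Complex.norm_exp]

omit [FiniteDimensional ℝ E] [MeasurableSpace E] [BorelSpace E] in
theorem continuous_shiftPhase : Continuous fun p : E × E × E => shiftPhase p.1 p.2.1 p.2.2 := by
  unfold shiftPhase
  fun_prop

/-- The two exponentials combine to `exp (2πi ξ·(t - x/2))`. With `x = t - s` the frequency argument
becomes `-(t + s)/2`, which explains `kernelEquiv`. -/
theorem integral_mul_shiftPhase (G : 𝓢(E × E, ℂ)) (x t : E) :
    ∫ ξ, G (x, ξ) * shiftPhase x ξ t = partialFourier G (x, (1 / 2 : ℝ) • x - t) := by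
  rw [partialFourier_apply, Real.fourier_eq]
  refine integral_congr_ae (Filter.Eventually.of_forall fun ξ => ?_)
  simp only [Circle.smul_def, Real.fourierChar_apply, shiftPhase, smul_eq_mul, ← Complex.exp_add]
  rw [mul_comm, inner_sub_right, inner_smul_right]
  congr 2
  push_cast
  ring

/-- Cauchy–Schwarz. By translation invariance the bound does not depend on `x`, which is what the
applications of Fubini need. -/
theorem norm_integral_le_of_memLp {g h : E → ℂ} (hg : MemLp g 2 volume) (hh : MemLp h 2 volume)
    (x : E) : ∫ t, ‖conj (h t) * g (t - x)‖ ≤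
      Real.sqrt (∫ t, ‖h t‖ ^ (2 : ℝ)) * Real.sqrt (∫ t, ‖g t‖ ^ (2 : ℝ)) := by
  have hg' : MemLp (fun t => g (t - x)) 2 volume :=
    hg.comp_measurePreserving (measurePreserving_sub_right volume x)
  have h2 : (2 : ℝ≥0∞) = ENNReal.ofReal 2 := by simp
  have := integral_mul_norm_le_Lp_mul_Lq (Real.HolderConjugate.two_two) (h2 ▸ hh) (h2 ▸ hg')
  rw [integral_sub_right_eq_self (fun t => ‖g t‖ ^ (2 : ℝ)) x, ← Real.sqrt_eq_rpow,
    ← Real.sqrt_eq_rpow] at this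
  simpa using this

theorem integrable_conj_mul_shift {g h : E → ℂ} (hg : MemLp g 2 volume) (hh : MemLp h 2 volume)
    (x : E) : Integrable fun t => conj (h t) * g (t - x) :=
  hh.star.integrable_mul (hg.comp_measurePreserving (measurePreserving_sub_right volume x))

instance isAddHaarMeasure_volume_prod : (volume : Measure (E × E)).IsAddHaarMeasure :=
  Measure.prod.instIsAddHaarMeasure _ _

/-- Two applications of Fubini. For fixed `x`, the integrals in `ξ` and `t` are exchanged, and the
`ξ`-integral becomes a partial Fourier transform. Its decay in `x`, uniform in the second variable,
then permits exchanging `x` and `t`. -/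
theorem integral_mul_shift_eq (G : 𝓢(E × E, ℂ)) {g h : E → ℂ} (hgm : StronglyMeasurable g)
    (hhm : StronglyMeasurable h) (hg : MemLp g 2 volume) (hh : MemLp h 2 volume) :
    ∫ z : E × E, G z * ∫ t, conj (h t) * (shiftPhase z.1 z.2 t * g (t - z.1)) =
      ∫ t, conj (h t) * ∫ s, shiftKernel G (t, s) * g s := by
  set M : ℝ := Real.sqrt (∫ t, ‖h t‖ ^ (2 : ℝ)) * Real.sqrt (∫ t, ‖g t‖ ^ (2 : ℝ)) with hM
  have hM0 : 0 ≤ M := by positivity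
  have hjoint : StronglyMeasurable fun p : (E × E) × E =>
      conj (h p.2) * (shiftPhase p.1.1 p.1.2 p.2 * g (p.2 - p.1.1)) := by
    refine (Complex.continuous_conj.comp_stronglyMeasurable
      (hhm.comp_measurable measurable_snd)).mul (StronglyMeasurable.mul ?_ ?_)
    · exact (continuous_shiftPhase.comp (g := fun p : E × E × E => shiftPhase p.1 p.2.1 p.2.2)
        (f := fun p : (E × E) × E => (p.1.1, p.1.2, p.2)) (by fun_prop)).stronglyMeasurable
    · exact hgm.comp_measurable (by fun_prop)
  have hint : Integrable (fun z : E × E =>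
      G z * ∫ t, conj (h t) * (shiftPhase z.1 z.2 t * g (t - z.1))) := by
    refine Integrable.mul_bdd (c := M) G.integrable
      hjoint.integral_prod_right.aestronglyMeasurable (Filter.Eventually.of_forall fun z => ?_)
    refine (norm_integral_le_integral_norm _).trans (le_trans (le_of_eq ?_)
      (norm_integral_le_of_memLp hg hh z.1))
    simp only [norm_mul, norm_shiftPhase, one_mul]
  have hswap1 : ∀ x, ∫ ξ, G (x, ξ) * ∫ t, conj (h t) * (shiftPhase x ξ t * g (t - x)) =
      ∫ t, conj (h t) * g (t - x) * partialFourier G (x, (1 / 2 : ℝ) • x - t) := by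
    intro x
    simp_rw [← integral_mul_shiftPhase, ← integral_const_mul]
    rw [integral_integral_swap]
    · congr 1; ext t; congr 1; ext ξ; ring
    · have h0 := (integrable_slice G x).mul_prod (integrable_conj_mul_shift hg hh x)
      have h1 : Continuous fun p : E × E => shiftPhase x p.1 p.2 :=
        continuous_shiftPhase.comp (g := fun p : E × E × E => shiftPhase p.1 p.2.1 p.2.2)
          (f := fun p : E × E => (x, p.1, p.2)) (by fun_prop)
      refine (h0.bdd_mul (c := 1) h1.aestronglyMeasurable
        (Filter.Eventually.of_forall fun p => (norm_shiftPhase _ _ _).le)).congr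
        (Filter.Eventually.of_forall fun p => ?_)
      simp only [Function.uncurry]
      ring
  rw [Measure.volume_eq_prod, integral_prod _ hint]
  simp_rw [hswap1]
  rw [integral_integral_swap]
  · refine integral_congr_ae (Filter.Eventually.of_forall fun t => ?_)
    simp only
    -- Substitution `x = t - s` in the inner integral.
    rw [← integral_const_mul, ← integral_sub_left_eq_self _ _ t]
    refine integral_congr_ae (Filter.Eventually.of_forall fun s => ?_)
    simp only [shiftKernel_apply, sub_sub_cancel]
    have : (1 / 2 : ℝ) • (t - s) - t = -((1 / 2 : ℝ) • (t + s)) := by module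
    rw [this]
    ring
  · obtain ⟨C, hC⟩ := exists_fst_bound (partialFourier G) (volume : Measure E).integrablePower
    have hm : AEStronglyMeasurable (Function.uncurry fun x t => conj (h t) * g (t - x) *
        partialFourier G (x, (1 / 2 : ℝ) • x - t)) ((volume : Measure E).prod volume) := by
      refine StronglyMeasurable.aestronglyMeasurable (StronglyMeasurable.mul (.mul ?_ ?_) ?_)
      · exact Complex.continuous_conj.comp_stronglyMeasurable (hhm.comp_measurable measurable_snd)
      · exact hgm.comp_measurable (by fun_prop)
      · exact ((partialFourier G).continuous.comp (by fun_prop)).stronglyMeasurable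
    have hb : ∀ x t, ‖conj (h t) * g (t - x) * partialFourier G (x, (1 / 2 : ℝ) • x - t)‖ ≤
        ‖conj (h t) * g (t - x)‖ *
          ((1 + ‖x‖) ^ (-((volume : Measure E).integrablePower : ℝ)) * C) := fun x t => by
      rw [norm_mul]
      gcongr
      exact hC _ _
    rw [integrable_prod_iff hm]
    have hi : ∀ x, Integrable fun t => conj (h t) * g (t - x) *
        partialFourier G (x, (1 / 2 : ℝ) • x - t) := fun x => by
      refine Integrable.mono' ((integrable_conj_mul_shift hg hh x).norm.mul_const _) ?_
        (Filter.Eventually.of_forall (hb x))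
      exact (integrable_conj_mul_shift hg hh x).1.mul
        ((partialFourier G).continuous.comp (by fun_prop)).aestronglyMeasurable
    refine ⟨Filter.Eventually.of_forall hi, ?_⟩
    have hpow := (volume : Measure E).integrable_pow_neg_integrablePower
    refine Integrable.mono' ((hpow.mul_const C).const_mul M) hm.norm.integral_prod_right'
      (Filter.Eventually.of_forall fun x => ?_)
    rw [Real.norm_of_nonneg (integral_nonneg fun t => norm_nonneg _)]
    have hC0 : 0 ≤ (1 + ‖x‖) ^ (-((volume : Measure E).integrablePower : ℝ)) * C :=
      (norm_nonneg _).trans (hC x 0)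
    calc ∫ t, ‖conj (h t) * g (t - x) * partialFourier G (x, (1 / 2 : ℝ) • x - t)‖
        ≤ ∫ t, ‖conj (h t) * g (t - x)‖ *
          ((1 + ‖x‖) ^ (-((volume : Measure E).integrablePower : ℝ)) * C) :=
          integral_mono (hi x).norm ((integrable_conj_mul_shift hg hh x).norm.mul_const _) (hb x)
      _ ≤ _ := by
          rw [integral_mul_const]
          exact mul_le_mul_of_nonneg_right (norm_integral_le_of_memLp hg hh x) hC0

end SchwartzMap
end PhaseSpaceShifts

/-! ### Restriction of metaplectic operators to Schwartz functions -/

noncomputable section SchwartzRestriction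

open scoped FourierTransform

namespace SchwartzMap

variable {E : Type} [NormedAddCommGroup E] [InnerProductSpace ℝ E] [FiniteDimensional ℝ E]
  [MeasurableSpace E] [BorelSpace E]

/-- The integral operator with Schwartz kernel `K`, evaluated at the Schwartz function `χ`, as a
map of `K`. -/
def kernelApply (χ : 𝓢(E, ℂ)) : 𝓢(E × E, ℂ) →L[ℝ] 𝓢(E, ℂ) :=
  (compCLM ℝ (g := ContinuousLinearMap.inl ℝ E E)
    (ContinuousLinearMap.inl ℝ E E).hasTemperateGrowth
    ⟨1, 1, fun x => by simp⟩).comp (partialFourier.comp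
      (bilinLeftCLM (ContinuousLinearMap.mul ℝ ℂ) (g := fun p : E × E => χ p.2)
        (χ.hasTemperateGrowth.comp (ContinuousLinearMap.snd ℝ E E).hasTemperateGrowth)))

/-- The integral over `s` is the value at frequency zero of a partial Fourier transform, so its
continuity in `K` comes from that of `partialFourier`. -/
theorem kernelApply_apply (χ : 𝓢(E, ℂ)) (K : 𝓢(E × E, ℂ)) (t : E) :
    kernelApply χ K t = ∫ s, K (t, s) * χ s := by
  change 𝓕 (fun s => K (t, s) * χ s) 0 = _
  simp [Real.fourier_eq]

end SchwartzMap

/-- The pushforward of `μ` under `L` is again a Haar measure, hence a multiple of `μ`. Only the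
independence of `c` from `F` matters later. -/
theorem MeasureTheory.exists_integral_comp_continuousLinearEquiv {X : Type*} [NormedAddCommGroup X]
    [NormedSpace ℝ X] [FiniteDimensional ℝ X] [MeasurableSpace X] [BorelSpace X] (μ : Measure X)
    [μ.IsAddHaarMeasure] (L : X ≃L[ℝ] X) :
    ∃ c : ℝ, ∀ F : X → ℂ, ∫ z, F (L z) ∂μ = c * ∫ z, F z ∂μ := by
  have h : (μ.map L).IsAddHaarMeasure := L.isAddHaarMeasure_map μ
  refine ⟨(μ.map L).addHaarScalarFactor μ, fun F => ?_⟩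
  have h1 : ∫ z, F (L z) ∂μ = ∫ z, F z ∂(μ.map L) :=
    (integral_map_equiv L.toHomeomorph.toMeasurableEquiv F).symm
  rw [h1]
  conv_lhs => rw [Measure.isAddLeftInvariant_eq_smul (μ.map L) μ]
  rw [integral_smul_nnreal_measure, NNReal.smul_def, Complex.real_smul]

namespace MetaplecticLocalization

variable {ι : Type} [Fintype ι]

/-- The identification of phase space with the product of its two components. -/
def splitEquiv : Euc (ι ⊕ ι) ≃L[ℝ] Euc ι × Euc ι :=
  LinearEquiv.toContinuousLinearEquiv
    { toFun := fun z => (fstPart z, sndPart z)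
      invFun := fun p => WithLp.toLp 2 (Sum.elim p.1 p.2)
      map_add' := fun _ _ => rfl
      map_smul' := fun _ _ => rfl
      left_inv := fun z => by ext i; cases i <;> rfl
      right_inv := fun p => rfl }

theorem inner_schrodinger (h g : LTwo ι) (z : Euc (ι ⊕ ι)) :
    inner ℂ h (schrodinger z 0 g) =
      ∫ t, conj (h t) * (shiftPhase (fstPart z) (sndPart z) t * g (t - fstPart z)) := by
  rw [L2.inner_def]
  refine integral_congr_ae ?_
  filter_upwards [(memLp_schrodinger (fstPart z) (sndPart z) 0 g).coeFn_toLp] with t ht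
  rw [schrodinger, ht]
  simp [shiftPhase, mul_comm]

theorem inner_eq_integral (h g : LTwo ι) : inner ℂ h g = ∫ t, conj (h t) * g t := by
  rw [L2.inner_def]
  simp [mul_comm]

theorem integral_mul_inner_schrodinger (G : 𝓢(Euc ι × Euc ι, ℂ)) (h g : LTwo ι) :
    ∫ z, G z * inner ℂ h (schrodinger (splitEquiv.symm z) 0 g) =
      ∫ t, conj (h t) * ∫ s, shiftKernel G (t, s) * g s := by
  simp_rw [inner_schrodinger]
  exact integral_mul_shift_eq G (Lp.stronglyMeasurable g) (Lp.stronglyMeasurable h)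
    (Lp.memLp g) (Lp.memLp h)

/-- The kernel `f(t) conj(φ(s))` as a function on the product, as a map of `f`. -/
def rankOneKernel (φ : 𝓢(Euc ι, ℂ)) : 𝓢(Euc ι, ℂ) →L[ℝ] 𝓢(Euc ι × Euc ι, ℂ) :=
  (compCLMOfContinuousLinearEquiv ℝ splitEquiv.symm).comp
    ((tensorFlipS (conjS φ)).restrictScalars ℝ)

theorem rankOneKernel_apply (φ f : 𝓢(Euc ι, ℂ)) (t s : Euc ι) :
    rankOneKernel φ f (t, s) = f t * conj (φ s) := rfl

/-- Weak reconstruction of `f` from its matrix coefficients. -/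
theorem integral_shiftSymbol_mul_inner (φ f : 𝓢(Euc ι, ℂ)) (h g : LTwo ι) :
    ∫ z, shiftSymbol (rankOneKernel φ f) z *
        inner ℂ h (schrodinger (splitEquiv.symm z) 0 g) =
      inner ℂ h (f.toLp 2) * inner ℂ (φ.toLp 2) g := by
  rw [integral_mul_inner_schrodinger, shiftKernel_shiftSymbol, inner_eq_integral,
    inner_eq_integral, ← integral_mul_const]
  refine integral_congr_ae ?_
  filter_upwards [f.coeFn_toLp 2] with t ht
  rw [ht, mul_assoc]
  congr 1
  rw [← integral_const_mul]
  refine integral_congr_ae ?_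
  filter_upwards [φ.coeFn_toLp 2] with s hs
  rw [hs, rankOneKernel_apply, mul_assoc]

theorem integral_mul_inner_schrodinger_toLp (G : 𝓢(Euc ι × Euc ι, ℂ)) (h : LTwo ι)
    (χ : 𝓢(Euc ι, ℂ)) :
    ∫ z, G z * inner ℂ h (schrodinger (splitEquiv.symm z) 0 (χ.toLp 2)) =
      inner ℂ h ((kernelApply χ (shiftKernel G)).toLp 2) := by
  rw [integral_mul_inner_schrodinger, inner_eq_integral]
  refine integral_congr_ae ?_
  filter_upwards [(kernelApply χ (shiftKernel G)).coeFn_toLp 2] with t ht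
  rw [ht, kernelApply_apply]
  congr 1
  refine integral_congr_ae ?_
  filter_upwards [χ.coeFn_toLp 2] with s hs
  rw [hs]

/-- A continuous map on Schwartz functions that represents `U` is automatically linear. -/
theorem exists_isSchwartzRestriction_of_continuous (U : LTwo ι ≃ₗᵢ[ℂ] LTwo ι)
    (T : 𝓢(Euc ι, ℂ) → 𝓢(Euc ι, ℂ)) (hT : Continuous T)
    (h : ∀ f : 𝓢(Euc ι, ℂ), (T f).toLp 2 = U (f.toLp 2)) :
    ∃ T, IsSchwartzRestriction U T := by
  have hadd : ∀ f g : 𝓢(Euc ι, ℂ), (f + g).toLp 2 volume =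
      f.toLp 2 volume + g.toLp 2 volume :=
    fun f g => map_add (toLpCLM ℂ ℂ 2 (volume : Measure (Euc ι))) f g
  have hsmul : ∀ (c : ℂ) (f : 𝓢(Euc ι, ℂ)), (c • f).toLp 2 volume = c • f.toLp 2 volume :=
    fun c f => map_smul (toLpCLM ℂ ℂ 2 (volume : Measure (Euc ι))) c f
  refine ⟨{ toFun := T, map_add' := fun f g => ?_, map_smul' := fun c f => ?_, cont := hT }, h⟩
  · apply injective_toLp 2 volume
    simp only [h, hadd, map_add]
  · apply injective_toLp 2 volume
    simp only [h, hsmul, map_smul, RingHom.id_apply]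

/-- Decompose `f` into phase space shifts of a window, with coefficients given by `φ`, move the
coefficients by `L`, and recompose with the window `χ`. -/
def moveShifts (L : (Euc ι × Euc ι) ≃L[ℝ] (Euc ι × Euc ι)) (φ χ : 𝓢(Euc ι, ℂ)) :
    𝓢(Euc ι, ℂ) →L[ℝ] 𝓢(Euc ι, ℂ) :=
  (kernelApply χ).comp (shiftKernel.comp
    ((compCLMOfContinuousLinearEquiv ℝ L.symm).comp (shiftSymbol.comp (rankOneKernel φ))))

/-- Both sides are the matrix coefficient at `h` and `χ` of the rank one operator `g ↦ ⟨g, φ⟩ f`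
conjugated by `U`: directly on the left, through the integrated shifts moved by `L` on the right. -/
theorem exists_inner_moveShifts (U : LTwo ι ≃ₗᵢ[ℂ] LTwo ι)
    (L : Euc (ι ⊕ ι) ≃L[ℝ] Euc (ι ⊕ ι))
    (hU : ∀ (z : Euc (ι ⊕ ι)) (g : LTwo ι),
      U (schrodinger z 0 (U.symm g)) = schrodinger (L z) 0 g) :
    ∃ c : ℂ, ∀ (φ χ f : 𝓢(Euc ι, ℂ)) (h : LTwo ι),
      inner ℂ h (U (f.toLp 2)) * inner ℂ (φ.toLp 2) (U.symm (χ.toLp 2)) =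
        c * inner ℂ h
          ((moveShifts ((splitEquiv.symm.trans L).trans splitEquiv) φ χ f).toLp 2) := by
  obtain ⟨c, hc⟩ := exists_integral_comp_continuousLinearEquiv
    (volume : Measure (Euc ι × Euc ι)) ((splitEquiv.symm.trans L).trans splitEquiv)
  refine ⟨c, fun φ χ f h => ?_⟩
  have hadj : ∀ g : LTwo ι, inner ℂ (U.symm h) g = inner ℂ h (U g) := fun g => by
    rw [← U.inner_map_map (U.symm h), U.apply_symm_apply]
  have h2 := integral_mul_inner_schrodinger_toLp
    (compCLMOfContinuousLinearEquiv ℝ ((splitEquiv.symm.trans L).trans splitEquiv).symm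
      (shiftSymbol (rankOneKernel φ f))) h χ
  refine Eq.trans ?_ (congrArg (fun w : ℂ => c * w) h2)
  -- The left side is expanded with `U⁻¹ h` and `U⁻¹ χ`, and the right side is pulled back along
  -- `L`. The integrands then agree by the intertwining relation.
  rw [← hadj, ← integral_shiftSymbol_mul_inner, ← hc]
  refine integral_congr_ae (Filter.Eventually.of_forall fun z => ?_)
  simp only
  rw [hadj, hU, compCLMOfContinuousLinearEquiv_apply, Function.comp_apply,
    ContinuousLinearEquiv.symm_apply_apply, ContinuousLinearEquiv.trans_apply,
    ContinuousLinearEquiv.trans_apply, ContinuousLinearEquiv.symm_apply_apply]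

theorem exists_toLp_inner_ne_zero {g : LTwo ι} (hg : g ≠ 0) :
    ∃ φ : 𝓢(Euc ι, ℂ), inner ℂ (φ.toLp 2) g ≠ 0 := by
  by_contra! H
  exact hg (DenseRange.eq_zero_of_inner_right ℂ
    (denseRange_toLpCLM (F := ℂ) (μ := (volume : Measure (Euc ι))) (p := 2) (by simp)) H)

/-- A unitary operator that acts on the Schrödinger representation by a linear automorphism of
phase space restricts to a continuous operator on Schwartz functions. -/
theorem exists_isSchwartzRestriction (U : LTwo ι ≃ₗᵢ[ℂ] LTwo ι)
    (L : Euc (ι ⊕ ι) ≃L[ℝ] Euc (ι ⊕ ι))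
    (hU : ∀ (z : Euc (ι ⊕ ι)) (g : LTwo ι),
      U (schrodinger z 0 (U.symm g)) = schrodinger (L z) 0 g) :
    ∃ T, IsSchwartzRestriction U T := by
  -- In the degenerate case the zero operator works, so no nonzero Schwartz function has to be
  -- exhibited.
  by_cases hχ : ∀ χ : 𝓢(Euc ι, ℂ), χ.toLp 2 (volume : Measure (Euc ι)) = 0
  · exact ⟨0, fun f => by rw [hχ f, hχ, map_zero]⟩
  push Not at hχ
  obtain ⟨χ, hχ⟩ := hχ
  obtain ⟨φ, hφ⟩ := exists_toLp_inner_ne_zero (g := U.symm (χ.toLp 2))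
    fun h => hχ ((map_eq_zero_iff _ U.symm.injective).1 h)
  obtain ⟨c, hc⟩ := exists_inner_moveShifts U L hU
  have hc' := hc φ χ
  generalize inner ℂ (φ.toLp 2) (U.symm (χ.toLp 2)) = a at hφ hc'
  generalize moveShifts ((splitEquiv.symm.trans L).trans splitEquiv) φ χ = R at hc'
  -- `R` is constructed only as a real-linear map. Continuity suffices here, since complex linearity
  -- is inherited from `U` through the injectivity of `toLp`.
  refine exists_isSchwartzRestriction_of_continuous U (fun f => (a⁻¹ * c) • R f)
    (R.continuous.const_smul (a⁻¹ * c)) fun f => ?_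
  have hR : ((a⁻¹ * c) • R f).toLp 2 volume = (a⁻¹ * c) • (R f).toLp 2 volume :=
    map_smul (toLpCLM ℂ ℂ 2 (volume : Measure (Euc ι))) _ _
  refine ext_inner_left ℂ fun h => ?_
  rw [hR, inner_smul_right, mul_assoc, ← hc' f h]
  field_simp

/-- The linear automorphism of phase space given by a symplectic matrix. -/
def matActEquiv [DecidableEq ι] (A : Matrix.symplecticGroup ι ℝ) :
    Euc (ι ⊕ ι) ≃L[ℝ] Euc (ι ⊕ ι) :=
  LinearEquiv.toContinuousLinearEquiv
    { toFun := matAct A.1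
      invFun := matAct (A⁻¹).1
      map_add' := fun x y => by simp [matAct, Matrix.mulVec_add]
      map_smul' := fun c x => by simp [matAct, Matrix.mulVec_smul]
      left_inv := fun x => by
        have h : (A⁻¹).1 * A.1 = 1 := congrArg Subtype.val (inv_mul_cancel A)
        simp only [matAct, Matrix.mulVec_mulVec, h, Matrix.one_mulVec]
      right_inv := fun x => by
        have h : A.1 * (A⁻¹).1 = 1 := congrArg Subtype.val (mul_inv_cancel A)
        simp only [matAct, Matrix.mulVec_mulVec, h, Matrix.one_mulVec] }

theorem isSchwartzRestriction_onSchwartz {U : LTwo ι ≃ₗᵢ[ℂ] LTwo ι}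
    (h : ∃ T, IsSchwartzRestriction U T) : IsSchwartzRestriction U (onSchwartz U) := by
  obtain ⟨T, hT⟩ := h
  exact hT.eq_onSchwartz ▸ hT

theorem IsMetaplectic.isSchwartzRestriction [DecidableEq ι] {A : Matrix.symplecticGroup ι ℝ}
    {U : LTwo ι ≃ₗᵢ[ℂ] LTwo ι} (hU : IsMetaplectic A U) :
    IsSchwartzRestriction U (onSchwartz U) :=
  isSchwartzRestriction_onSchwartz
    (exists_isSchwartzRestriction U (matActEquiv A) fun z g => hU z 0 g)

theorem IsMetaplectic.isSchwartzRestriction_symm [DecidableEq ι]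
    {A : Matrix.symplecticGroup ι ℝ} {U : LTwo ι ≃ₗᵢ[ℂ] LTwo ι} (hU : IsMetaplectic A U) :
    IsSchwartzRestriction U.symm (onSchwartz U.symm) := by
  refine isSchwartzRestriction_onSchwartz
    (exists_isSchwartzRestriction U.symm (matActEquiv A).symm fun z g => ?_)
  -- The relation for `U⁻¹` at `z` is that for `U` at `A⁻¹ z`, applied to `U g`.
  have h := hU ((matActEquiv A).symm z) 0 (U g)
  rw [U.symm_apply_apply, show matAct A.1 ((matActEquiv A).symm z) = z from
    (matActEquiv A).apply_symm_apply z] at h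
  rw [U.symm_symm, ← h, U.symm_apply_apply]

end MetaplecticLocalization
end SchwartzRestriction

/-! ### The kernel formula -/

theorem proposition3 (d : ℕ) (A : Matrix.symplecticGroup (Fin d ⊕ Fin d) ℝ)
    (U : LTwo (Fin d ⊕ Fin d) ≃ₗᵢ[ℂ] LTwo (Fin d ⊕ Fin d)) (hU : IsMetaplectic A U) :
    IsSchwartzRestriction U (onSchwartz U) ∧
    IsSchwartzRestriction U.symm (onSchwartz U.symm) ∧
    ∀ (φ₁ φ₂ : 𝓢(EuclideanSpace ℝ (Fin d), ℂ))
      (a : 𝓢'(EuclideanSpace ℝ (Fin d ⊕ Fin d), ℂ)),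
      IsSchwartzKernel (localizationOp U a φ₁ φ₂)
        (onDist U.symm (convDist a (wigner U φ₂ φ₁))) := by
  refine ⟨hU.isSchwartzRestriction, hU.isSchwartzRestriction_symm, fun φ₁ φ₂ a f g => ?_⟩
  -- Duality moves `U⁻¹` off the distribution as `(U⁻¹)⁻¹ = U` on the test function, and `U (g ⊗
  -- f̄)` is by definition `W(g, f)`.
  rw [localizationOp, bracket_metaplecticOp, bracket_onDist, U.symm_symm]
  rfl
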